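/- Let $n\ge 2$, $0<\rho<\tfrac12$, $0<\theta<\tfrac{\pi}{2}$. Write $x=(x',x_n)\in\mathbb R^{n-1}\times\mathbb R$, let $e_n$ be the unit vector in the $x_n$-direction, and let $B(c,r)$ be the open ball with centre $c$ and radius $r$, $B_1=B(0,1)$. Put $$\mathscr A_{\rho,\theta}=\{x\in B_1:\ x_n<\cot\theta\,|x'|,\ |x-\rho e_n|>\rho\},\qquad \Sigma_\theta=\{x\in S^{n-1}:\ x_n<\cot\theta\,|x'|\},$$ and let $\lambda_1(n,\theta)$ be the first Dirichlet eigenvalue of the Laplace–Beltrami operator on $\Sigma_\theta$, that is, $\lambda_1(n,\theta)=\inf\int_{\Sigma_\theta}|\nabla\varphi|^2dS\big/\int_{\Sigma_\theta}\varphi^2dS$ over $0\ne\varphi\in C_c^\infty(\Sigma_\theta)$. For an open set $U\subset\mathbb R^n$ with $0\notin U$ let $$H(U)=\inf_{0\neq u\in C_c^\infty(U)}\frac{\int_U|\nabla u|^2\,dx}{\int_U \frac{u^2}{|x|^2}\,dx}$$ be its Hardy constant. An exterior ball of $U$ at $0$ is a ball $B(c,r)$ with $|c|=r>0$ contained in the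 complement of $\overline U$. Let $\Omega\subset\mathbb R^n$ be a domain (open and connected) that contains $\mathscr A_{\rho,\theta}$ and whose largest exterior ball at $0$ is $B(\rho e_n,\rho)$. Then $\lambda_1(n,\theta)<n-1$, and if $$\rho<\frac{1}{2\cos\theta}\,\exp\Big(-\frac{\pi}{\sqrt{n-1-\lambda_1(n,\theta)}}\Big),$$ then $$H(\Omega)\ \le\ H(\mathscr A_{\rho,\theta})\ <\ \frac{n^2}{4}.$$ In particular the Hardy inequality with constant $n^2/4$ fails in $\Omega$: there is $u\in C_c^\infty(\Omega)$ with $\int_\Omega|\nabla u|^2dx<\frac{n^2}{4}\int_\Omega\frac{u^2}{|x|^2}dx$. -/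

import Mathlib

open MeasureTheory Metric Set
open scoped ContDiff

noncomputable section

namespace HardyBoundary

/-- Euclidean space `ℝⁿ`. -/
abbrev E (n : ℕ) : Type := EuclideanSpace ℝ (Fin n)

/-- The unit sphere `S^{n-1}` of `ℝⁿ`. -/
abbrev S (n : ℕ) : Type := sphere (0 : E n) 1

/-- The index of the last coordinate `x_n` of a point `x = (x', x_n)` of `ℝⁿ`. -/
def last (n : ℕ) (hn : 2 ≤ n) : Fin n := ⟨n - 1, by omega⟩

/-- The unit vector `e_n` in the direction of the last coordinate. -/
def eLast (n : ℕ) (hn : 2 ≤ n) : E n := EuclideanSpace.single (last n hn) (1 : ℝ)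

/-- The Euclidean norm `|x'|` of the first `n - 1` coordinates of `x = (x', x_n)`. -/
def normPrime {n : ℕ} (hn : 2 ≤ n) (x : E n) : ℝ :=
  √(∑ i ∈ Finset.univ.erase (last n hn), x i ^ 2)

/-! ### Hardy constant of an open set -/

/-- `u ∈ C_c^∞(Ω)`: a smooth function on `ℝⁿ` with compact support contained in `Ω`. -/
structure IsTestFunction {n : ℕ} (Ω : Set (E n)) (u : E n → ℝ) : Prop where
  smooth : ContDiff ℝ ∞ u
  compact : HasCompactSupport u
  support_subset : tsupport u ⊆ Ω

/-- The Dirichlet energy `∫_Ω |∇u|² dx`. -/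
def energy {n : ℕ} (Ω : Set (E n)) (u : E n → ℝ) : ℝ :=
  ∫ x in Ω, ‖gradient u x‖ ^ 2

/-- The Hardy term `∫_Ω u² / |x|² dx`. -/
def hardyTerm {n : ℕ} (Ω : Set (E n)) (u : E n → ℝ) : ℝ :=
  ∫ x in Ω, u x ^ 2 / ‖x‖ ^ 2

/-- The Hardy constant of `Ω` with singularity at the origin: the infimum of
`∫_Ω |∇u|² / ∫_Ω u²/|x|²` over all `u ∈ C_c^∞(Ω)`, `u ≠ 0`. -/
def hardyConstant {n : ℕ} (Ω : Set (E n)) : ℝ :=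
  sInf {q : ℝ | ∃ u : E n → ℝ, IsTestFunction Ω u ∧ u ≠ 0 ∧ q = energy Ω u / hardyTerm Ω u}

/-! ### Exterior balls at the origin -/

/-- `B(c, r)` is an exterior ball of `Ω` at the origin: the origin lies on its boundary sphere and
the ball is contained in the complement of the closure of `Ω`. -/
def IsExteriorBallAtZero {n : ℕ} (Ω : Set (E n)) (c : E n) (r : ℝ) : Prop :=
  0 < r ∧ ‖c‖ = r ∧ ball c r ⊆ (closure Ω)ᶜ

/-- `B(c, r)` is the largest exterior ball of `Ω` at the origin. -/
def IsLargestExteriorBallAtZero {n : ℕ} (Ω : Set (E n)) (c : E n) (r : ℝ) : Prop :=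
  IsExteriorBallAtZero Ω c r ∧
    ∀ (c' : E n) (r' : ℝ), IsExteriorBallAtZero Ω c' r' → r' ≤ r

/-! ### The first Dirichlet eigenvalue of an open subset of the sphere -/

/-- The extension of a function on the sphere to a function on `ℝⁿ ∖ {0}` that is constant on rays
from the origin, `x ↦ φ (x / |x|)` (with the value `0` at the origin). -/
def rayExtension {n : ℕ} (φ : S n → ℝ) (x : E n) : ℝ :=
  open Classical in
  if hx : x = 0 then 0
  else φ ⟨‖x‖⁻¹ • x, by
    rw [mem_sphere_zero_iff_norm, norm_smul, norm_inv, norm_norm,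
      inv_mul_cancel₀ (norm_ne_zero_iff.mpr hx)]⟩

/-- `φ ∈ C_c^∞(U)` for a subset `U` of the sphere. A function on the sphere is smooth iff its
extension that is constant on rays is smooth away from the origin; the sphere being compact, only
the inclusion of the closed support in `U` has to be asked for. -/
structure IsSphericalTestFunction {n : ℕ} (U : Set (S n)) (φ : S n → ℝ) : Prop where
  smooth : ContDiffOn ℝ ∞ (rayExtension φ) {0}ᶜ
  support_subset : tsupport φ ⊆ U

/-- The gradient on the sphere for the round metric, as a vector of the ambient space:
the Euclidean gradient of the extension that is constant on rays, at points of the sphere. -/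
def sphericalGradient {n : ℕ} (φ : S n → ℝ) (ξ : S n) : E n :=
  gradient (rayExtension φ) (ξ : E n)

/-- The first eigenvalue of the Laplace–Beltrami operator on an open subset `U` of the unit sphere
under Dirichlet boundary conditions: the infimum of `∫_U |∇φ|² dS / ∫_U φ² dS` over all
`φ ∈ C_c^∞(U)`, `φ ≠ 0`, where `dS` is surface measure. -/
def firstDirichletEigenvalue {n : ℕ} (U : Set (S n)) : ℝ :=
  sInf {q : ℝ | ∃ φ : S n → ℝ, IsSphericalTestFunction U φ ∧ φ ≠ 0 ∧
    q = (∫ ξ in U, ‖sphericalGradient φ ξ‖ ^ 2 ∂(volume : Measure (E n)).toSphere) /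
      (∫ ξ in U, φ ξ ^ 2 ∂(volume : Measure (E n)).toSphere)}

/-! ### The model domain and the spherical cap -/

/-- `𝒜_{ρ,θ} = {x ∈ B_1 : x_n < cot θ |x'|, |x - ρ e_n| > ρ}`. -/
def modelDomain (n : ℕ) (hn : 2 ≤ n) (ρ θ : ℝ) : Set (E n) :=
  {x | x ∈ ball (0 : E n) 1 ∧ x (last n hn) < Real.cot θ * normPrime hn x ∧
    ρ < ‖x - ρ • eLast n hn‖}

/-- The spherical cap `Σ_θ = {(x', x_n) ∈ S^{n-1} : x_n < cot θ |x'|}`. -/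
def sphericalCap (n : ℕ) (hn : 2 ≤ n) (θ : ℝ) : Set (S n) :=
  {ξ | (ξ : E n) (last n hn) < Real.cot θ * normPrime hn (ξ : E n)}

/-- `λ_1(n, θ)`, the first Dirichlet eigenvalue of the spherical cap `Σ_θ`. -/
def capEigenvalue (n : ℕ) (hn : 2 ≤ n) (θ : ℝ) : ℝ :=
  firstDirichletEigenvalue (sphericalCap n hn θ)

end HardyBoundary

end

/-!
In log-polar coordinates `x = e^s ξ` a product `u(x) = w(s) φ(ξ)` has
`∫ u²/|x|² = ∫ φ² · ∫ w² e^{(n-2)s}` and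
`∫ |∇u|² = ∫ φ² · ∫ w'² e^{(n-2)s} + ∫ |∇φ|² · ∫ w² e^{(n-2)s}`. The ground-state substitution
`w = v e^{-(n-2)s/2}` removes the weight and turns the quotient into
`((n-2)/2)² + ∫ v'²/∫ v² + ∫ |∇φ|²/∫ φ²`. For `log (2ρ cos θ) < s < 0` and `ξ ∈ Σ_θ` the point
`e^s ξ` lies in `𝒜_{ρ,θ}`, and over `C_c^∞` of that interval the middle term has infimum
`(π / log (2ρ cos θ))²`. As `n²/4 = ((n-2)/2)² + (n-1)`, the quotient can be brought below `n²/4`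
as soon as `(π / log (2ρ cos θ))² < n - 1 - λ₁`.

Both the bound `λ₁ < n - 1` and the functions `v` come from one trick, which avoids approximating
eigenfunctions by test functions. Let `g ≥ 0` be smooth and convex, zero on `[d, ∞)` for some
`d > 0`, with `g(t) = g(0) - t` for `t ≤ 0`; then `t g'(t) ≤ g(t)`. If `Δp = -l p`, where `l ≥ 0`
and `{p ≤ d}` is contained in the given open set, then
`∫ |∇(g ∘ p)|² = ∫ g'(p)² |∇p|² ≤ ∫ (g g')'(p) |∇p|² = l ∫ p g(p) g'(p) ≤ l ∫ g(p)²`.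
Here `p` is `x_n` on the sphere, with `l = n - 1`, and a cosine on the interval.
-/

namespace HardyBoundary

section LogPolar

variable {F : Type*} [NormedAddCommGroup F] [NormedSpace ℝ F]

theorem norm_exp_smul_sphere (s : ℝ) (ξ : sphere (0 : F) 1) :
    ‖Real.exp s • (ξ : F)‖ = Real.exp s := by
  rw [norm_smul, norm_eq_of_mem_sphere ξ, mul_one, Real.norm_eq_abs, Real.abs_exp]

theorem exp_smul_sphere_ne_zero (s : ℝ) (ξ : sphere (0 : F) 1) : Real.exp s • (ξ : F) ≠ 0 :=
  smul_ne_zero (Real.exp_ne_zero s) (ne_zero_of_mem_unit_sphere ξ)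

theorem exists_exp_smul_sphere_eq {x : F} (hx : x ≠ 0) :
    ∃ (s : ℝ) (ξ : sphere (0 : F) 1), Real.exp s • (ξ : F) = x := by
  have hx' : 0 < ‖x‖ := norm_pos_iff.2 hx
  refine ⟨Real.log ‖x‖, ⟨‖x‖⁻¹ • x, ?_⟩, ?_⟩
  · rw [mem_sphere_zero_iff_norm, norm_smul, norm_inv, norm_norm, inv_mul_cancel₀ hx'.ne']
  · rw [Real.exp_log hx', smul_inv_smul₀ hx'.ne']

theorem measurePreserving_expOrderIso (k : ℕ) :
    MeasurePreserving Real.expOrderIso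
      (volume.withDensity fun s => ENNReal.ofReal (Real.exp ((k + 1) * s)))
      (Measure.volumeIoiPow k) := by
  have hmeas : Measurable Real.expOrderIso := Real.expOrderIso.toHomeomorph.continuous.measurable
  refine ⟨hmeas, Measure.ext fun t ht => ?_⟩
  have himage : (↑) '' t = Real.exp '' (Real.expOrderIso ⁻¹' t) := by
    rw [← image_preimage_eq t Real.expOrderIso.surjective, image_image,
      preimage_image_eq _ Real.expOrderIso.injective]
    simp only [Real.coe_expOrderIso_apply]
  rw [Measure.map_apply hmeas ht, withDensity_apply _ (hmeas ht), Measure.volumeIoiPow,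
    withDensity_apply _ ht, setLIntegral_subtype measurableSet_Ioi t
      fun r => ENNReal.ofReal (r ^ k), himage,
    lintegral_image_eq_lintegral_abs_deriv_mul (hmeas ht)
      (fun s _ => (Real.hasDerivAt_exp s).hasDerivWithinAt) Real.exp_injective.injOn]
  refine lintegral_congr fun s => ?_
  rw [Real.abs_exp, ← ENNReal.ofReal_mul (Real.exp_nonneg s), ← Real.exp_nat_mul, ← Real.exp_add]
  ring_nf

variable [FiniteDimensional ℝ F] [Nontrivial F] [MeasurableSpace F] [BorelSpace F]
  {G : Type*} [NormedAddCommGroup G] [NormedSpace ℝ G]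

theorem integral_eq_integral_toSphere_prod_exp (μ : Measure F) [μ.IsAddHaarMeasure] (f : F → G) :
    ∫ x, f x ∂μ = ∫ z, Real.exp (Module.finrank ℝ F * z.2) • f (Real.exp z.2 • (z.1 : F))
      ∂(μ.toSphere.prod volume) := by
  have hexp := (MeasurePreserving.id μ.toSphere).prod
    (measurePreserving_expOrderIso (Module.finrank ℝ F - 1))
  have hemb : MeasurableEmbedding (Prod.map id Real.expOrderIso :
      sphere (0 : F) 1 × ℝ → sphere (0 : F) 1 × Ioi (0 : ℝ)) :=
    MeasurableEmbedding.id.prodMap Real.expOrderIso.toHomeomorph.measurableEmbedding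
  have hdim : ((Module.finrank ℝ F - 1 : ℕ) : ℝ) + 1 = Module.finrank ℝ F := by
    exact_mod_cast Nat.sub_add_cancel Module.finrank_pos
  calc ∫ x, f x ∂μ
      = ∫ x : ({0}ᶜ : Set F), f x ∂(μ.comap (↑)) := by
        rw [integral_subtype_comap (measurableSet_singleton _).compl, restrict_compl_singleton]
    _ = ∫ z, f ((z.2 : ℝ) • (z.1 : F))
          ∂(μ.toSphere.prod (.volumeIoiPow (Module.finrank ℝ F - 1))) := by
        rw [← μ.measurePreserving_homeomorphUnitSphereProd.integral_comp
          (Homeomorph.measurableEmbedding _)]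
        refine integral_congr_ae (.of_forall fun x => ?_)
        exact congrArg (fun y : ({0}ᶜ : Set F) => f y)
          ((homeomorphUnitSphereProd F).symm_apply_apply x).symm
    _ = _ := by
        rw [← hexp.integral_comp hemb, prod_withDensity_right (by fun_prop),
          integral_withDensity_eq_integral_toReal_smul (by fun_prop)
            (.of_forall fun _ => ENNReal.ofReal_lt_top)]
        simp only [Prod.map_fst, Prod.map_snd, id_eq, Real.coe_expOrderIso_apply, hdim,
          ENNReal.toReal_ofReal (Real.exp_nonneg _)]

theorem integral_eq_add_of_exp_smul_eq {μ : Measure F} [μ.IsAddHaarMeasure] {f : F → ℝ}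
    {w₁ w₂ : ℝ → ℝ} {b₁ b₂ : sphere (0 : F) 1 → ℝ} (hw₁ : Integrable w₁) (hw₂ : Integrable w₂)
    (hb₁ : Integrable b₁ μ.toSphere) (hb₂ : Integrable b₂ μ.toSphere)
    (hf : ∀ s (ξ : sphere (0 : F) 1), Real.exp (Module.finrank ℝ F * s) * f (Real.exp s • (ξ : F)) =
      b₁ ξ * w₁ s + b₂ ξ * w₂ s) :
    ∫ x, f x ∂μ =
      (∫ ξ, b₁ ξ ∂μ.toSphere) * (∫ s, w₁ s) + (∫ ξ, b₂ ξ ∂μ.toSphere) * ∫ s, w₂ s := by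
  rw [integral_eq_integral_toSphere_prod_exp, ← integral_prod_mul, ← integral_prod_mul,
    ← integral_add (hb₁.mul_prod hw₁) (hb₂.mul_prod hw₂)]
  simp only [smul_eq_mul, hf]

end LogPolar

section RayExtension

variable {n : ℕ} {φ : S n → ℝ} {ξ : S n}

theorem rayExtension_zero (φ : S n → ℝ) : rayExtension φ 0 = 0 :=
  dif_pos rfl

theorem rayExtension_smul_of_pos (φ : S n → ℝ) {r : ℝ} (hr : 0 < r) (x : E n) :
    rayExtension φ (r • x) = rayExtension φ x := by
  rcases eq_or_ne x 0 with rfl | hx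
  · rw [smul_zero]
  · rw [rayExtension, rayExtension, dif_neg hx, dif_neg (smul_ne_zero hr.ne' hx)]
    congr 2
    rw [norm_smul, Real.norm_of_nonneg hr.le, mul_inv_rev, smul_smul, mul_assoc,
      inv_mul_cancel₀ hr.ne', mul_one]

theorem rayExtension_coe (φ : S n → ℝ) (ξ : S n) : rayExtension φ ξ = φ ξ := by
  rw [rayExtension, dif_neg (ne_zero_of_mem_unit_sphere ξ)]
  congr 1
  ext1
  simp only [norm_eq_of_mem_sphere ξ, inv_one, one_smul]

theorem rayExtension_exp_smul (φ : S n → ℝ) (s : ℝ) (ξ : S n) :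
    rayExtension φ (Real.exp s • (ξ : E n)) = φ ξ := by
  rw [rayExtension_smul_of_pos φ (Real.exp_pos s), rayExtension_coe]

theorem differentiableAt_rayExtension (hφ : ContDiffOn ℝ 1 (rayExtension φ) {0}ᶜ) (ξ : S n) :
    DifferentiableAt ℝ (rayExtension φ) ξ :=
  (hφ.contDiffAt (isOpen_compl_singleton.mem_nhds (ne_zero_of_mem_unit_sphere ξ))).differentiableAt
    one_ne_zero

theorem continuous_of_continuousOn_rayExtension (hφ : ContinuousOn (rayExtension φ) {0}ᶜ) :
    Continuous φ :=
  (hφ.comp_continuous continuous_subtype_val ne_zero_of_mem_unit_sphere).congr (rayExtension_coe φ)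

theorem continuous_sphericalGradient (hφ : ContDiffOn ℝ 1 (rayExtension φ) {0}ᶜ) :
    Continuous (sphericalGradient φ) := by
  have hgradient : ContinuousOn (gradient (rayExtension φ)) {0}ᶜ :=
    (LinearIsometryEquiv.continuous _).comp_continuousOn
      (hφ.continuousOn_fderiv_of_isOpen isOpen_compl_singleton le_rfl)
  exact hgradient.comp_continuous continuous_subtype_val ne_zero_of_mem_unit_sphere

theorem hasGradientAt_rayExtension_exp_smul (hφ : DifferentiableAt ℝ (rayExtension φ) ξ) (s : ℝ) :
    HasGradientAt (rayExtension φ) (Real.exp (-s) • sphericalGradient φ ξ)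
      (Real.exp s • (ξ : E n)) := by
  have hscale : rayExtension φ ∘ (Real.exp (-s) • ·) = rayExtension φ :=
    funext fun x => rayExtension_smul_of_pos φ (Real.exp_pos _) x
  have hpoint : Real.exp (-s) • Real.exp s • (ξ : E n) = ξ := by
    rw [smul_smul, ← Real.exp_add, neg_add_cancel, Real.exp_zero, one_smul]
  have hgradient : HasGradientAt (rayExtension φ) (sphericalGradient φ ξ)
      (Real.exp (-s) • Real.exp s • (ξ : E n)) := by
    rw [hpoint]
    exact hφ.hasGradientAt
  have hcomp := hgradient.hasFDerivAt.comp (Real.exp s • (ξ : E n))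
    ((hasFDerivAt_id _).const_smul (Real.exp (-s)))
  rw [hasGradientAt_iff_hasFDerivAt]
  refine (hscale ▸ hcomp).congr_fderiv ?_
  ext v
  simp

theorem inner_sphericalGradient_self (φ : S n → ℝ) (ξ : S n) :
    inner ℝ (sphericalGradient φ ξ) (ξ : E n) = 0 := by
  by_cases hφ : DifferentiableAt ℝ (rayExtension φ) ξ
  · have hray : HasDerivAt (fun s => Real.exp s • (ξ : E n)) (ξ : E n) 0 := by
      simpa using (Real.hasDerivAt_exp 0).smul_const (ξ : E n)
    have hgradient := (hasGradientAt_rayExtension_exp_smul hφ 0).hasFDerivAt.comp_hasDerivAt 0 hray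
    have hconst : rayExtension φ ∘ (fun s => Real.exp s • (ξ : E n)) = fun _ => φ ξ :=
      funext fun s => rayExtension_exp_smul φ s ξ
    rw [hconst, neg_zero, Real.exp_zero, one_smul] at hgradient
    exact hgradient.unique (hasDerivAt_const 0 (φ ξ))
  · rw [sphericalGradient, gradient_eq_zero_of_not_differentiableAt hφ, inner_zero_left]

theorem sphericalGradient_eq_zero_of_notMem_tsupport (hξ : ξ ∉ tsupport φ) :
    sphericalGradient φ ξ = 0 := by
  have hclosed : IsClosed ((↑) '' tsupport φ : Set (E n)) :=
    ((isClosed_tsupport φ).isCompact.image continuous_subtype_val).isClosed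
  have hcont : ContinuousAt (fun x : E n => ‖x‖⁻¹ • x) ξ :=
    (continuous_norm.continuousAt.inv₀ (norm_ne_zero_iff.2 (ne_zero_of_mem_unit_sphere ξ))).smul
      continuousAt_id
  have hnear : ∀ᶠ x in nhds (ξ : E n), ‖x‖⁻¹ • x ∉ ((↑) '' tsupport φ : Set (E n)) := by
    refine hcont.eventually (hclosed.isOpen_compl.mem_nhds ?_)
    simpa only [norm_eq_of_mem_sphere ξ, inv_one, one_smul, mem_compl_iff,
      Subtype.val_injective.mem_set_image] using hξ
  have hzero : rayExtension φ =ᶠ[nhds (ξ : E n)] fun _ => 0 := by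
    filter_upwards [hnear] with x hx
    by_contra hne
    rw [rayExtension] at hne
    split_ifs at hne with h0
    · exact hne rfl
    · exact hx ⟨_, subset_tsupport φ hne, rfl⟩
  rw [sphericalGradient, hzero.gradient_eq, gradient_fun_const]

end RayExtension

section LogProduct

variable {n : ℕ} {w : ℝ → ℝ} {φ : S n → ℝ}

/-- The product `x ↦ w (log |x|) φ (x / |x|)` of a function of the logarithm of the radius and a
function of the direction, with the value `0` at the origin. -/
noncomputable def logProduct (w : ℝ → ℝ) (φ : S n → ℝ) (x : E n) : ℝ :=
  w (Real.log ‖x‖) * rayExtension φ x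

theorem logProduct_exp_smul (w : ℝ → ℝ) (φ : S n → ℝ) (s : ℝ) (ξ : S n) :
    logProduct w φ (Real.exp s • (ξ : E n)) = w s * φ ξ := by
  rw [logProduct, norm_exp_smul_sphere, Real.log_exp, rayExtension_exp_smul]

theorem logProduct_zero (w : ℝ → ℝ) (φ : S n → ℝ) : logProduct w φ 0 = 0 := by
  rw [logProduct, rayExtension_zero, mul_zero]

theorem isCompact_exp_smul_image (hw : HasCompactSupport w) (φ : S n → ℝ) :
    IsCompact ((fun p : ℝ × S n => Real.exp p.1 • (p.2 : E n)) '' (tsupport w ×ˢ tsupport φ)) :=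
  (hw.isCompact.prod (isClosed_tsupport φ).isCompact).image (by fun_prop)

theorem tsupport_logProduct_subset (hw : HasCompactSupport w) (φ : S n → ℝ) :
    tsupport (logProduct w φ) ⊆
      (fun p : ℝ × S n => Real.exp p.1 • (p.2 : E n)) '' (tsupport w ×ˢ tsupport φ) := by
  refine closure_minimal (fun x hx => ?_) (isCompact_exp_smul_image hw φ).isClosed
  have hx0 : x ≠ 0 := fun h => hx (h ▸ logProduct_zero w φ)
  obtain ⟨s, ξ, rfl⟩ := exists_exp_smul_sphere_eq hx0
  rw [Function.mem_support, logProduct_exp_smul] at hx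
  exact ⟨(s, ξ), ⟨subset_tsupport w (left_ne_zero_of_mul hx),
    subset_tsupport φ (right_ne_zero_of_mul hx)⟩, rfl⟩

theorem hasCompactSupport_logProduct (hw : HasCompactSupport w) (φ : S n → ℝ) :
    HasCompactSupport (logProduct w φ) :=
  (isCompact_exp_smul_image hw φ).of_isClosed_subset (isClosed_tsupport _)
    (tsupport_logProduct_subset hw φ)

theorem zero_notMem_tsupport_logProduct (hw : HasCompactSupport w) (φ : S n → ℝ) :
    (0 : E n) ∉ tsupport (logProduct w φ) := fun h => by
  obtain ⟨p, -, hp⟩ := tsupport_logProduct_subset hw φ h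
  exact exp_smul_sphere_ne_zero p.1 p.2 hp

theorem contDiff_logProduct {k : WithTop ℕ∞} (hw : HasCompactSupport w) (hwk : ContDiff ℝ k w)
    (hφ : ContDiffOn ℝ k (rayExtension φ) {0}ᶜ) : ContDiff ℝ k (logProduct w φ) := by
  rw [contDiff_iff_contDiffAt]
  intro x
  rcases eq_or_ne x 0 with rfl | hx
  · exact contDiffAt_const.congr_of_eventuallyEq
      (notMem_tsupport_iff_eventuallyEq.1 (zero_notMem_tsupport_logProduct hw φ))
  · have hlog : ContDiffAt ℝ k (fun y : E n => Real.log ‖y‖) x :=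
      (contDiffAt_norm ℝ hx).log (norm_ne_zero_iff.2 hx)
    exact (hwk.contDiffAt.comp x hlog).mul (hφ.contDiffAt (isOpen_compl_singleton.mem_nhds hx))

theorem hasGradientAt_log_norm {F : Type*} [NormedAddCommGroup F] [InnerProductSpace ℝ F]
    [CompleteSpace F] {x : F} (hx : x ≠ 0) :
    HasGradientAt (fun y => Real.log ‖y‖) ((‖x‖ ^ 2)⁻¹ • x) x := by
  have hsq : HasFDerivAt (fun y => 1 / 2 * Real.log (‖y‖ ^ 2))
      ((1 / 2 : ℝ) • (‖x‖ ^ 2)⁻¹ • (2 • innerSL ℝ x)) x :=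
    ((hasStrictFDerivAt_norm_sq x).hasFDerivAt.log
      (pow_ne_zero 2 (norm_ne_zero_iff.2 hx))).const_mul (1 / 2)
  have hlog (y : F) : Real.log ‖y‖ = 1 / 2 * Real.log (‖y‖ ^ 2) := by
    rw [Real.log_pow, Nat.cast_ofNat]
    ring
  rw [hasGradientAt_iff_hasFDerivAt, funext hlog]
  refine hsq.congr_fderiv ?_
  ext v
  simp
  ring

theorem hasGradientAt_logProduct {s : ℝ} {ξ : S n} (hw : DifferentiableAt ℝ w s)
    (hφ : DifferentiableAt ℝ (rayExtension φ) ξ) :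
    HasGradientAt (logProduct w φ)
      (Real.exp (-s) • ((deriv w s * φ ξ) • (ξ : E n) + w s • sphericalGradient φ ξ))
      (Real.exp s • (ξ : E n)) := by
  have hlog : Real.log ‖Real.exp s • (ξ : E n)‖ = s := by
    rw [norm_exp_smul_sphere, Real.log_exp]
  have hradial : HasDerivAt w (deriv w s) (Real.log ‖Real.exp s • (ξ : E n)‖) :=
    hlog.symm ▸ hw.hasDerivAt
  have hlogGrad : HasGradientAt (fun y : E n => Real.log ‖y‖) (Real.exp (-s) • (ξ : E n))
      (Real.exp s • (ξ : E n)) := by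
    convert hasGradientAt_log_norm (exp_smul_sphere_ne_zero s ξ) using 1
    rw [norm_exp_smul_sphere, smul_smul, Real.exp_neg]
    congr 1
    field_simp
  have hprod := (hradial.comp_hasFDerivAt (Real.exp s • (ξ : E n)) hlogGrad.hasFDerivAt).mul
    (hasGradientAt_rayExtension_exp_smul hφ s).hasFDerivAt
  refine hasGradientAt_iff_hasFDerivAt.2 (hprod.congr_fderiv ?_)
  rw [Function.comp_apply, hlog, rayExtension_exp_smul]
  simp only [← map_smul, ← map_add]
  congr 1
  module

theorem norm_gradient_logProduct_sq {s : ℝ} {ξ : S n} (hw : DifferentiableAt ℝ w s)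
    (hφ : DifferentiableAt ℝ (rayExtension φ) ξ) :
    ‖gradient (logProduct w φ) (Real.exp s • (ξ : E n))‖ ^ 2 =
      Real.exp (-s) ^ 2 * (deriv w s ^ 2 * φ ξ ^ 2 + w s ^ 2 * ‖sphericalGradient φ ξ‖ ^ 2) := by
  rw [(hasGradientAt_logProduct hw hφ).gradient, norm_smul, mul_pow, norm_add_sq_real,
    inner_smul_left, inner_smul_right, real_inner_comm, inner_sphericalGradient_self, norm_smul,
    norm_smul, norm_eq_of_mem_sphere ξ]
  simp only [mul_pow, Real.norm_eq_abs, sq_abs]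
  ring

theorem exp_mul_exp_neg_sq (n s : ℝ) :
    Real.exp (n * s) * Real.exp (-s) ^ 2 = Real.exp ((n - 2) * s) := by
  rw [← Real.exp_nat_mul, ← Real.exp_add]
  push_cast
  ring_nf

theorem integral_logProduct_sq_div_norm_sq [Nontrivial (E n)] (w : ℝ → ℝ) (φ : S n → ℝ) :
    ∫ x, logProduct w φ x ^ 2 / ‖x‖ ^ 2 =
      (∫ ξ, φ ξ ^ 2 ∂.toSphere volume) * ∫ s, w s ^ 2 * Real.exp ((n - 2) * s) := by
  rw [integral_eq_integral_toSphere_prod_exp, ← integral_prod_mul]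
  refine integral_congr_ae (.of_forall fun z => ?_)
  simp only [finrank_euclideanSpace_fin, logProduct_exp_smul, norm_exp_smul_sphere, smul_eq_mul]
  rw [← exp_mul_exp_neg_sq, Real.exp_neg]
  field_simp

theorem integrable_mul_of_hasCompactSupport {X : Type*} [TopologicalSpace X] [MeasurableSpace X]
    [OpensMeasurableSpace X] {μ : Measure X} [IsFiniteMeasureOnCompacts μ] {v g : X → ℝ}
    (hvc : Continuous v) (hv : HasCompactSupport v) (hg : Continuous g) :
    Integrable (fun x => v x * g x) μ :=
  (hvc.mul hg).integrable_of_hasCompactSupport hv.mul_right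

theorem integral_norm_gradient_logProduct_sq [Nontrivial (E n)] (hw : HasCompactSupport w)
    (hw1 : ContDiff ℝ 1 w) (hφ : ContDiffOn ℝ 1 (rayExtension φ) {0}ᶜ) :
    ∫ x, ‖gradient (logProduct w φ) x‖ ^ 2 =
      (∫ ξ, φ ξ ^ 2 ∂.toSphere volume) * (∫ s, deriv w s ^ 2 * Real.exp ((n - 2) * s)) +
        (∫ ξ, ‖sphericalGradient φ ξ‖ ^ 2 ∂.toSphere volume) *
          ∫ s, w s ^ 2 * Real.exp ((n - 2) * s) := by
  have hw' : Continuous (deriv w) := hw1.continuous_deriv le_rfl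
  have hφc := continuous_of_continuousOn_rayExtension hφ.continuousOn
  have hφ' := continuous_sphericalGradient hφ
  have hsq {v : ℝ → ℝ} (hv : HasCompactSupport v) (hvc : Continuous v) :
      Integrable fun s => v s ^ 2 * Real.exp ((n - 2) * s) :=
    integrable_mul_of_hasCompactSupport (hvc.pow 2)
      (hv.comp_left (g := (· ^ 2)) (zero_pow two_ne_zero)) (by fun_prop)
  refine integral_eq_add_of_exp_smul_eq (hsq hw.deriv hw') (hsq hw hw1.continuous)
    (Continuous.integrable_of_hasCompactSupport (by fun_prop) (.of_compactSpace _))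
    (Continuous.integrable_of_hasCompactSupport (by fun_prop) (.of_compactSpace _)) fun s ξ => ?_
  rw [norm_gradient_logProduct_sq (hw1.differentiable one_ne_zero s)
    (differentiableAt_rayExtension hφ ξ), finrank_euclideanSpace_fin, ← mul_assoc,
    exp_mul_exp_neg_sq]
  ring

end LogProduct

section Divergence

theorem integral_fderiv_apply_eq_zero {F : Type*} [NormedAddCommGroup F]
    [NormedSpace ℝ F] [FiniteDimensional ℝ F] [MeasurableSpace F] [BorelSpace F]
    {μ : Measure F} [μ.IsAddHaarMeasure] {f : F → ℝ} (hf : ContDiff ℝ 1 f)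
    (hc : HasCompactSupport f) (v : F) : ∫ x, fderiv ℝ f x v ∂μ = 0 := by
  have hf' : Integrable (fun x => fderiv ℝ f x v) μ :=
    ((hf.continuous_fderiv one_ne_zero).clm_apply continuous_const).integrable_of_hasCompactSupport
      (hc.fderiv_apply ℝ v)
  simpa using integral_mul_fderiv_eq_neg_fderiv_mul_of_integrable (𝕜 := ℝ) (μ := μ)
    (f := fun _ => (1 : ℝ)) (g := f) (v := v) (by simp) (by simpa using hf')
    (by simpa using hf.continuous.integrable_of_hasCompactSupport hc)
    (fun x _ => differentiableAt_const _) (fun x _ => hf.differentiable one_ne_zero x)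

theorem integral_deriv_mul_exp {w : ℝ → ℝ} (hw1 : ContDiff ℝ 1 w) (hw : HasCompactSupport w)
    (c : ℝ) : ∫ s, deriv w s * Real.exp (c * s) = -c * ∫ s, w s * Real.exp (c * s) := by
  have hexp (s : ℝ) : HasDerivAt (fun s => Real.exp (c * s)) (c * Real.exp (c * s)) s := by
    simpa [mul_comm] using ((hasDerivAt_id s).const_mul c).exp
  have hparts := integral_mul_deriv_eq_deriv_mul_of_integrable
    (fun s _ => (hw1.differentiable one_ne_zero s).hasDerivAt) (fun s _ => hexp s)
    (integrable_mul_of_hasCompactSupport hw1.continuous hw (by fun_prop))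
    (integrable_mul_of_hasCompactSupport (hw1.continuous_deriv le_rfl) hw.deriv (by fun_prop))
    (integrable_mul_of_hasCompactSupport hw1.continuous hw (by fun_prop))
  rw [← integral_const_mul, ← neg_eq_iff_eq_neg.2 hparts, ← integral_neg]
  exact integral_congr_ae (.of_forall fun s => by ring)

theorem integral_fderiv_logProduct_apply {n : ℕ} [Nontrivial (E n)] {w : ℝ → ℝ} {φ : S n → ℝ}
    (hw : HasCompactSupport w) (hw1 : ContDiff ℝ 1 w)
    (hφ : ContDiffOn ℝ 1 (rayExtension φ) {0}ᶜ) (e : E n) :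
    ∫ x, fderiv ℝ (logProduct w φ) x e =
      (∫ ξ, inner ℝ e (ξ : E n) * φ ξ ∂.toSphere volume) *
          (∫ s, deriv w s * Real.exp ((n - 1) * s)) +
        (∫ ξ, inner ℝ e (sphericalGradient φ ξ) ∂.toSphere volume) *
          ∫ s, w s * Real.exp ((n - 1) * s) := by
  have hφc := continuous_of_continuousOn_rayExtension hφ.continuousOn
  have hφ' := continuous_sphericalGradient hφ
  refine integral_eq_add_of_exp_smul_eq
    (integrable_mul_of_hasCompactSupport (hw1.continuous_deriv le_rfl) hw.deriv (by fun_prop))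
    (integrable_mul_of_hasCompactSupport hw1.continuous hw (by fun_prop))
    (Continuous.integrable_of_hasCompactSupport (by fun_prop) (.of_compactSpace _))
    (Continuous.integrable_of_hasCompactSupport (by fun_prop) (.of_compactSpace _)) fun s ξ => ?_
  rw [(hasGradientAt_logProduct (hw1.differentiable one_ne_zero s)
    (differentiableAt_rayExtension hφ ξ)).fderiv_apply, real_inner_comm, inner_smul_right,
    inner_add_right, inner_smul_right, inner_smul_right, finrank_euclideanSpace_fin,
    show (n - 1) * s = n * s + -s by ring, Real.exp_add]
  ring

/-- Integrate over `ℝⁿ` the derivative along `e` of `η (log |x|) φ (x / |x|)` for a bump function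
`η`; the factor `n - 1` comes from the radial integrals. -/
theorem integral_inner_sphericalGradient {n : ℕ} [Nontrivial (E n)] {φ : S n → ℝ}
    (hφ : ContDiffOn ℝ 1 (rayExtension φ) {0}ᶜ) (e : E n) :
    ∫ ξ, inner ℝ e (sphericalGradient φ ξ) ∂.toSphere volume =
      (n - 1) * ∫ ξ, inner ℝ e (ξ : E n) * φ ξ ∂.toSphere volume := by
  let η : ContDiffBump (0 : ℝ) := default
  have hη : ContDiff ℝ 1 (η : ℝ → ℝ) := η.contDiff
  have hη0 : 0 < η 0 := η.pos_of_mem_ball (mem_ball_self η.rOut_pos)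
  have hηexp : 0 < ∫ s, η s * Real.exp ((n - 1) * s) :=
    Continuous.integral_pos_of_hasCompactSupport_nonneg_nonzero (by fun_prop)
      η.hasCompactSupport.mul_right (fun s => mul_nonneg η.nonneg (Real.exp_nonneg _))
      (mul_pos hη0 (Real.exp_pos _)).ne'
  have hpolar := integral_fderiv_logProduct_apply η.hasCompactSupport hη hφ e
  rw [integral_fderiv_apply_eq_zero (contDiff_logProduct η.hasCompactSupport hη hφ)
    (hasCompactSupport_logProduct η.hasCompactSupport φ), integral_deriv_mul_exp hη
    η.hasCompactSupport] at hpolar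
  apply mul_right_cancel₀ hηexp.ne'
  linear_combination -hpolar

end Divergence

section ConvexProfile

/-- A smooth convex function on the line that vanishes exactly on `[d, ∞)` and whose tangent lines
at the points of `(-∞, d)` are positive at `0`.

If `p` solves `Δp = -l p`, then `v = g ∘ p` satisfies `∫ |∇v|² ≤ l ∫ p g(p) g'(p) ≤ l ∫ v²`: such
functions turn solutions into admissible functions supported in `{p ≤ d}`. -/
structure IsConvexProfile (d : ℝ) (g : ℝ → ℝ) : Prop where
  smooth : ContDiff ℝ ∞ g
  convex : ∀ t, 0 ≤ deriv (deriv g) t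
  pos : ∀ t < d, 0 < g t
  eq_zero : ∀ t, d ≤ t → g t = 0
  mul_deriv_lt : ∀ t < d, t * deriv g t < g t

namespace IsConvexProfile

variable {d : ℝ} {g : ℝ → ℝ}

theorem contDiff_deriv (hg : IsConvexProfile d g) : ContDiff ℝ ∞ (deriv g) :=
  (contDiff_infty_iff_deriv.1 hg.smooth).2

theorem nonneg (hg : IsConvexProfile d g) (t : ℝ) : 0 ≤ g t :=
  (lt_or_ge t d).elim (fun ht => (hg.pos t ht).le) fun ht => (hg.eq_zero t ht).ge

theorem mul_deriv_le (hg : IsConvexProfile d g) (t : ℝ) : t * deriv g t ≤ g t := by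
  rcases lt_or_ge t d with ht | ht
  · exact (hg.mul_deriv_lt t ht).le
  · have hmin : IsLocalMin g t := .of_forall fun s => (hg.eq_zero t ht).trans_le (hg.nonneg s)
    rw [hmin.deriv_eq_zero, mul_zero]
    exact hg.nonneg t

theorem deriv_sq_le (hg : IsConvexProfile d g) (t : ℝ) :
    deriv g t ^ 2 ≤ deriv (fun s => g s * deriv g s) t := by
  rw [deriv_fun_mul (hg.smooth.differentiable (by simp) t)
    (hg.contDiff_deriv.differentiable (by simp) t)]
  linarith [mul_nonneg (hg.nonneg t) (hg.convex t)]

theorem mul_mul_deriv_le (hg : IsConvexProfile d g) (t : ℝ) : t * (g t * deriv g t) ≤ g t ^ 2 := by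
  linarith [mul_le_mul_of_nonneg_left (hg.mul_deriv_le t) (hg.nonneg t)]

end IsConvexProfile

theorem isConvexProfile_integral {d : ℝ} {h : ℝ → ℝ} (hd : 0 < d) (hsmooth : ContDiff ℝ ∞ h)
    (h_anti : Antitone h) (h_one : ∀ s ≤ 0, h s = 1) (h_pos : ∀ s < d, 0 < h s)
    (h_zero : ∀ s, d ≤ s → h s = 0) : IsConvexProfile d fun t => ∫ s in t..d, h s := by
  have h_int (s t : ℝ) : IntervalIntegrable h volume s t :=
    hsmooth.continuous.intervalIntegrable s t
  let g : ℝ → ℝ := fun t => ∫ s in t..d, h s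
  have hg (t : ℝ) : HasDerivAt g (-h t) t :=
    intervalIntegral.integral_hasDerivAt_left (h_int t d)
      hsmooth.continuous.stronglyMeasurable.stronglyMeasurableAtFilter
      hsmooth.continuous.continuousAt
  have hg' : deriv g = fun t => -h t := funext fun t => (hg t).deriv
  have g_pos (t : ℝ) (ht : t < d) : 0 < g t :=
    intervalIntegral.intervalIntegral_pos_of_pos_on (h_int t d) (fun s hs => h_pos s hs.2) ht
  have g_affine (t : ℝ) (ht : t ≤ 0) : g t = g 0 - t := by
    have h_unit : ∫ s in t..0, h s = -t := by
      rw [intervalIntegral.integral_congr (g := fun _ => (1 : ℝ))]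
      · simp
      · exact fun s hs => h_one s (uIcc_of_le ht ▸ hs).2
    linarith [intervalIntegral.integral_add_adjacent_intervals (h_int t 0) (h_int 0 d)]
  refine ⟨?smooth, fun t => ?convex, g_pos, fun t ht => ?eq_zero, fun t ht => ?mul_deriv_lt⟩
  case smooth =>
    exact contDiff_infty_iff_deriv.2 ⟨fun t => (hg t).differentiableAt, hg' ▸ hsmooth.neg⟩
  case convex =>
    rw [hg']
    exact Monotone.deriv_nonneg fun s t hst => neg_le_neg (h_anti hst)
  case eq_zero =>
    refine intervalIntegral.integral_zero_ae (.of_forall fun s hs => h_zero s ?_)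
    exact (uIoc_of_ge ht ▸ hs).1.le
  case mul_deriv_lt =>
    rw [hg']
    rcases le_or_gt 0 t with h0 | h0
    · exact (mul_nonpos_of_nonneg_of_nonpos h0 (neg_nonpos.2 (h_pos t ht).le)).trans_lt (g_pos t ht)
    · simp only [h_one t h0.le]
      linarith [g_affine t h0.le, g_pos 0 hd]

theorem exists_isConvexProfile {d : ℝ} (hd : 0 < d) : ∃ g, IsConvexProfile d g := by
  let h : ℝ → ℝ := fun s => Real.smoothTransition (1 - s / d)
  have h_one (s : ℝ) (hs : s ≤ 0) : h s = 1 :=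
    Real.smoothTransition.one_of_one_le (by linarith [div_nonpos_of_nonpos_of_nonneg hs hd.le])
  have h_pos (s : ℝ) (hs : s < d) : 0 < h s :=
    Real.smoothTransition.pos_of_pos (sub_pos.2 ((div_lt_one hd).2 hs))
  have h_zero (s : ℝ) (hs : d ≤ s) : h s = 0 :=
    Real.smoothTransition.zero_of_nonpos (sub_nonpos.2 ((one_le_div hd).2 hs))
  exact ⟨_, isConvexProfile_integral hd (Real.smoothTransition.contDiff.comp (by fun_prop))
    (fun s t hst => Real.smoothTransition.monotone (by gcongr)) h_one h_pos h_zero⟩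

end ConvexProfile

section Height

variable {n : ℕ}

theorem rayExtension_comp (G : ℝ → ℝ) (ψ : S n → ℝ) {x : E n} (hx : x ≠ 0) :
    rayExtension (G ∘ ψ) x = G (rayExtension ψ x) := by
  rw [rayExtension, rayExtension, dif_neg hx, dif_neg hx, Function.comp_apply]

theorem contDiffOn_rayExtension_comp {k : WithTop ℕ∞} {G : ℝ → ℝ} (hG : ContDiff ℝ k G)
    {ψ : S n → ℝ} (hψ : ContDiffOn ℝ k (rayExtension ψ) {0}ᶜ) :
    ContDiffOn ℝ k (rayExtension (G ∘ ψ)) {0}ᶜ :=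
  (hG.comp_contDiffOn hψ).congr fun _ hx => rayExtension_comp G ψ hx

theorem sphericalGradient_comp {G : ℝ → ℝ} {ψ : S n → ℝ} {ξ : S n}
    (hG : DifferentiableAt ℝ G (ψ ξ)) (hψ : DifferentiableAt ℝ (rayExtension ψ) ξ) :
    sphericalGradient (G ∘ ψ) ξ = deriv G (ψ ξ) • sphericalGradient ψ ξ := by
  have hcomp : HasFDerivAt (G ∘ rayExtension ψ)
      (deriv G (ψ ξ) • InnerProductSpace.toDual ℝ (E n) (sphericalGradient ψ ξ)) (ξ : E n) := by
    rw [← rayExtension_coe ψ ξ] at hG ⊢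
    exact hG.hasDerivAt.comp_hasFDerivAt _ hψ.hasGradientAt.hasFDerivAt
  refine HasGradientAt.gradient (hasGradientAt_iff_hasFDerivAt.2 ?_)
  rw [map_smul]
  refine hcomp.congr_of_eventuallyEq ?_
  filter_upwards [isOpen_compl_singleton.mem_nhds (ne_zero_of_mem_unit_sphere ξ)] with x hx
    using rayExtension_comp G ψ hx

/-- The restriction to the sphere of the linear function `x ↦ ⟪e, x⟫`, a spherical harmonic of
degree one. -/
noncomputable def height (e : E n) (ξ : S n) : ℝ := inner ℝ e (ξ : E n)

theorem continuous_height (e : E n) : Continuous (height e) := by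
  unfold height
  fun_prop

theorem rayExtension_height (e x : E n) :
    rayExtension (height e) x = ‖x‖⁻¹ * inner ℝ e x := by
  rcases eq_or_ne x 0 with rfl | hx
  · rw [rayExtension_zero, inner_zero_right, mul_zero]
  · rw [rayExtension, dif_neg hx, height, inner_smul_right]

theorem contDiffOn_rayExtension_height {k : WithTop ℕ∞} (e : E n) :
    ContDiffOn ℝ k (rayExtension (height e)) {0}ᶜ := by
  rw [funext (rayExtension_height e)]
  intro x hx
  exact (((contDiffAt_norm ℝ hx).inv (norm_ne_zero_iff.2 hx)).mul
    (innerSL ℝ e).contDiff.contDiffAt).contDiffWithinAt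

theorem logProduct_exp_height (e : E n) : logProduct Real.exp (height e) = innerSL ℝ e := by
  ext x
  rcases eq_or_ne x 0 with rfl | hx
  · rw [logProduct_zero, map_zero]
  · have hx' : 0 < ‖x‖ := norm_pos_iff.2 hx
    rw [logProduct, Real.exp_log hx', rayExtension_height, mul_inv_cancel_left₀ hx'.ne',
      innerSL_apply_apply]

theorem sphericalGradient_height (e : E n) (ξ : S n) :
    sphericalGradient (height e) ξ = e - height e ξ • (ξ : E n) := by
  have hprod := hasGradientAt_logProduct (Real.differentiableAt_exp (x := 0))
    (differentiableAt_rayExtension (contDiffOn_rayExtension_height e) ξ)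
  have hlinear : HasGradientAt (innerSL ℝ e) e (Real.exp 0 • (ξ : E n)) := (innerSL ℝ e).hasFDerivAt
  rw [logProduct_exp_height] at hprod
  simpa [eq_sub_iff_add_eq'] using hprod.unique hlinear

theorem inner_sphericalGradient_height (e : E n) (ξ : S n) :
    inner ℝ e (sphericalGradient (height e) ξ) = ‖sphericalGradient (height e) ξ‖ ^ 2 := by
  have he : e = sphericalGradient (height e) ξ + height e ξ • (ξ : E n) := by
    rw [sphericalGradient_height, sub_add_cancel]
  nth_rw 1 [he]
  rw [inner_add_left, inner_smul_left, real_inner_comm _ (ξ : E n), inner_sphericalGradient_self,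
    mul_zero, add_zero, real_inner_self_eq_norm_sq]

theorem integral_deriv_comp_height [Nontrivial (E n)] {G : ℝ → ℝ} (hG : ContDiff ℝ 1 G) (e : E n) :
    ∫ ξ, deriv G (height e ξ) * ‖sphericalGradient (height e) ξ‖ ^ 2 ∂.toSphere volume =
      (n - 1) * ∫ ξ, height e ξ * G (height e ξ) ∂.toSphere volume := by
  have hdiv := integral_inner_sphericalGradient
    (contDiffOn_rayExtension_comp hG (contDiffOn_rayExtension_height e)) e
  simp only [sphericalGradient_comp (hG.differentiable one_ne_zero _)
    (differentiableAt_rayExtension (contDiffOn_rayExtension_height e) _), inner_smul_right,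
    inner_sphericalGradient_height] at hdiv
  exact hdiv

theorem integral_norm_sphericalGradient_comp_height_sq_le [Nontrivial (E n)] {d : ℝ} {g : ℝ → ℝ}
    (hg : IsConvexProfile d g) (e : E n) :
    ∫ ξ, ‖sphericalGradient (g ∘ height e) ξ‖ ^ 2 ∂.toSphere volume ≤
      (n - 1) * ∫ ξ, height e ξ * (g (height e ξ) * deriv g (height e ξ)) ∂.toSphere volume := by
  have hgg' : ContDiff ℝ ∞ fun t => g t * deriv g t := hg.smooth.mul hg.contDiff_deriv
  have hh := continuous_height e
  have hh' := continuous_sphericalGradient (contDiffOn_rayExtension_height e)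
  have hg' := hg.contDiff_deriv.continuous
  have hgg'' : Continuous (deriv fun t => g t * deriv g t) :=
    (contDiff_infty_iff_deriv.1 hgg').2.continuous
  rw [← integral_deriv_comp_height (hgg'.of_le (by simp)) e]
  simp only [sphericalGradient_comp (hg.smooth.differentiable (by simp) _)
    (differentiableAt_rayExtension (contDiffOn_rayExtension_height e) _), norm_smul, mul_pow,
    Real.norm_eq_abs, sq_abs]
  refine integral_mono
    (Continuous.integrable_of_hasCompactSupport (by fun_prop) (.of_compactSpace _))
    (Continuous.integrable_of_hasCompactSupport (by fun_prop) (.of_compactSpace _)) fun ξ => ?_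
  exact mul_le_mul_of_nonneg_right (hg.deriv_sq_le _) (sq_nonneg _)

end Height

section RayleighQuotient

variable {n : ℕ} {U : Set (S n)} {φ : S n → ℝ}

/-- The Rayleigh quotient `∫ |∇φ|² dS / ∫ φ² dS` over the whole sphere, whose infimum over
`C_c^∞(U) ∖ {0}` is the first Dirichlet eigenvalue of `U`. -/
noncomputable def rayleighQuotient (φ : S n → ℝ) : ℝ :=
  (∫ ξ, ‖sphericalGradient φ ξ‖ ^ 2 ∂.toSphere volume) / ∫ ξ, φ ξ ^ 2 ∂.toSphere volume

theorem rayleighQuotient_nonneg (φ : S n → ℝ) : 0 ≤ rayleighQuotient φ :=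
  div_nonneg (integral_nonneg fun _ => sq_nonneg _) (integral_nonneg fun _ => sq_nonneg _)

theorem IsSphericalTestFunction.continuous (hφ : IsSphericalTestFunction U φ) : Continuous φ :=
  continuous_of_continuousOn_rayExtension hφ.smooth.continuousOn

theorem IsSphericalTestFunction.integral_sq_pos (hφ : IsSphericalTestFunction U φ) (hφ0 : φ ≠ 0) :
    0 < ∫ ξ, φ ξ ^ 2 ∂.toSphere volume := by
  obtain ⟨ξ, hξ⟩ := Function.ne_iff.1 hφ0
  have hφc := hφ.continuous
  exact Continuous.integral_pos_of_hasCompactSupport_nonneg_nonzero (by fun_prop)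
    (.of_compactSpace _) (fun _ => sq_nonneg _) (pow_ne_zero 2 hξ)

theorem firstDirichletEigenvalue_eq_sInf (U : Set (S n)) :
    firstDirichletEigenvalue U =
      sInf (rayleighQuotient '' {φ | IsSphericalTestFunction U φ ∧ φ ≠ 0}) := by
  unfold firstDirichletEigenvalue
  congr! 1
  ext q
  refine exists_congr fun φ => ?_
  rw [mem_ofPred_eq, and_assoc, eq_comm (a := q)]
  refine and_congr_right fun hφ => and_congr_right fun _ => ?_
  have hnotMem (ξ : S n) (hξ : ξ ∉ U) : ξ ∉ tsupport φ := fun h => hξ (hφ.support_subset h)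
  rw [rayleighQuotient, setIntegral_eq_integral_of_forall_compl_eq_zero,
    setIntegral_eq_integral_of_forall_compl_eq_zero]
  · intro ξ hξ
    rw [image_eq_zero_of_notMem_tsupport (hnotMem ξ hξ), sq, mul_zero]
  · intro ξ hξ
    rw [sphericalGradient_eq_zero_of_notMem_tsupport (hnotMem ξ hξ), norm_zero, sq, mul_zero]

theorem firstDirichletEigenvalue_le_rayleighQuotient (hφ : IsSphericalTestFunction U φ)
    (hφ0 : φ ≠ 0) : firstDirichletEigenvalue U ≤ rayleighQuotient φ := by
  rw [firstDirichletEigenvalue_eq_sInf]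
  refine csInf_le ⟨0, ?_⟩ (mem_image_of_mem _ ⟨hφ, hφ0⟩)
  rintro _ ⟨ψ, -, rfl⟩
  exact rayleighQuotient_nonneg ψ

theorem exists_rayleighQuotient_lt (hU : ∃ φ, IsSphericalTestFunction U φ ∧ φ ≠ 0) {c : ℝ}
    (hc : firstDirichletEigenvalue U < c) :
    ∃ φ, IsSphericalTestFunction U φ ∧ φ ≠ 0 ∧ rayleighQuotient φ < c := by
  rw [firstDirichletEigenvalue_eq_sInf] at hc
  obtain ⟨_, ⟨φ, ⟨hφ, hφ0⟩, rfl⟩, hlt⟩ := exists_lt_of_csInf_lt (Nonempty.image _ hU) hc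
  exact ⟨φ, hφ, hφ0, hlt⟩

end RayleighQuotient

section Cap

variable {n : ℕ}

theorem nontrivial_of_two_le (hn : 2 ≤ n) : Nontrivial (E n) :=
  Module.nontrivial_of_finrank_pos (R := ℝ) (by rw [finrank_euclideanSpace_fin]; omega)

theorem exists_height_nonpos [Nontrivial (E n)] (e : E n) : ∃ ξ, height e ξ ≤ 0 := by
  obtain ⟨x, hx⟩ := exists_norm_eq (E n) zero_le_one
  rcases le_total (inner ℝ e x) 0 with h | h
  · exact ⟨⟨x, mem_sphere_zero_iff_norm.2 hx⟩, h⟩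
  · refine ⟨⟨-x, mem_sphere_zero_iff_norm.2 ((norm_neg x).trans hx)⟩, ?_⟩
    rw [height, inner_neg_right]
    exact neg_nonpos.2 h

theorem rayleighQuotient_comp_height_lt (hn : 2 ≤ n) {d : ℝ} {g : ℝ → ℝ} (hg : IsConvexProfile d g)
    {e : E n} {ξ : S n} (hξ : height e ξ < d) : rayleighQuotient (g ∘ height e) < n - 1 := by
  have := nontrivial_of_two_le hn
  have hh := continuous_height e
  have hgc := hg.smooth.continuous
  have hg'c := hg.contDiff_deriv.continuous
  have hdiff : 0 < ∫ ξ, (g (height e ξ) ^ 2 -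
      height e ξ * (g (height e ξ) * deriv g (height e ξ))) ∂.toSphere volume := by
    refine Continuous.integral_pos_of_hasCompactSupport_nonneg_nonzero (by fun_prop)
      (.of_compactSpace _) (fun ζ => sub_nonneg.2 (hg.mul_mul_deriv_le _)) (x := ξ) (ne_of_gt ?_)
    linarith [mul_lt_mul_of_pos_left (hg.mul_deriv_lt _ hξ) (hg.pos _ hξ)]
  rw [integral_sub (Continuous.integrable_of_hasCompactSupport (by fun_prop) (.of_compactSpace _))
    (Continuous.integrable_of_hasCompactSupport (by fun_prop) (.of_compactSpace _))] at hdiff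
  have hpos : 0 < ∫ ξ, g (height e ξ) ^ 2 ∂.toSphere volume :=
    Continuous.integral_pos_of_hasCompactSupport_nonneg_nonzero (by fun_prop)
      (.of_compactSpace _) (fun _ => sq_nonneg _) (pow_ne_zero 2 (hg.pos _ hξ).ne')
  have hn1 : (0 : ℝ) < n - 1 := by
    rw [sub_pos, Nat.one_lt_cast]
    omega
  refine (div_lt_iff₀ hpos).2 ?_
  exact (integral_norm_sphericalGradient_comp_height_sq_le hg e).trans_lt
    (mul_lt_mul_of_pos_left (sub_pos.1 hdiff) hn1)

theorem exists_rayleighQuotient_lt_on_cap (hn : 2 ≤ n) (e : E n) {c : ℝ} (hc : 0 < c) :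
    ∃ φ, IsSphericalTestFunction {ξ | height e ξ < c} φ ∧ φ ≠ 0 ∧ rayleighQuotient φ < n - 1 := by
  have := nontrivial_of_two_le hn
  obtain ⟨g, hg⟩ := exists_isConvexProfile (half_pos hc)
  obtain ⟨ξ, hξ⟩ := exists_height_nonpos e
  have hξ' : height e ξ < c / 2 := hξ.trans_lt (half_pos hc)
  refine ⟨g ∘ height e,
    ⟨contDiffOn_rayExtension_comp hg.smooth (contDiffOn_rayExtension_height e), ?_⟩, ?_,
    rayleighQuotient_comp_height_lt hn hg hξ'⟩
  · have hsub : tsupport (g ∘ height e) ⊆ {ξ | height e ξ ≤ c / 2} :=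
      closure_minimal (fun ζ hζ => not_lt.1 fun h => hζ (hg.eq_zero _ h.le))
        (isClosed_le (continuous_height e) continuous_const)
    exact hsub.trans fun ζ (hζ : height e ζ ≤ c / 2) => hζ.trans_lt (half_lt_self hc)
  · exact Function.ne_iff.2 ⟨ξ, (hg.pos _ hξ').ne'⟩

theorem norm_eLast (hn : 2 ≤ n) : ‖eLast n hn‖ = 1 := by
  rw [eLast, EuclideanSpace.single, PiLp.norm_single, norm_one]

theorem height_eLast (hn : 2 ≤ n) (ξ : S n) : height (eLast n hn) ξ = (ξ : E n) (last n hn) := by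
  rw [height, eLast, EuclideanSpace.inner_single_left, map_one, one_mul]

theorem height_eLast_sq_add_normPrime_sq (hn : 2 ≤ n) (ξ : S n) :
    height (eLast n hn) ξ ^ 2 + normPrime hn (ξ : E n) ^ 2 = 1 := by
  rw [height_eLast, normPrime, Real.sq_sqrt (Finset.sum_nonneg fun i _ => sq_nonneg _),
    Finset.add_sum_erase Finset.univ (fun i => (ξ : E n) i ^ 2) (Finset.mem_univ _),
    ← EuclideanSpace.real_norm_sq_eq, norm_eq_of_mem_sphere ξ, one_pow]

theorem cos_pos_of_mem_Ioo_zero_pi_div_two {θ : ℝ} (hθ : θ ∈ Ioo 0 (Real.pi / 2)) :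
    0 < Real.cos θ :=
  Real.cos_pos_of_mem_Ioo ⟨by linarith [hθ.1, Real.pi_pos], hθ.2⟩

theorem lt_cot_mul_iff_lt_cos {θ : ℝ} (hθ : θ ∈ Ioo 0 (Real.pi / 2)) {t p : ℝ} (hp : 0 ≤ p)
    (htp : t ^ 2 + p ^ 2 = 1) : t < Real.cot θ * p ↔ t < Real.cos θ := by
  have hsin : 0 < Real.sin θ := Real.sin_pos_of_pos_of_lt_pi hθ.1 (by linarith [hθ.2, Real.pi_pos])
  have hcos := cos_pos_of_mem_Ioo_zero_pi_div_two hθ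
  have hsq := Real.sin_sq_add_cos_sq θ
  rw [Real.cot_eq_cos_div_sin, div_mul_eq_mul_div, lt_div_iff₀ hsin]
  rcases lt_or_ge t (Real.cos θ) with h | h
  · refine iff_of_true ?_ h
    rcases lt_or_ge t 0 with ht | ht
    · exact (mul_neg_of_neg_of_pos ht hsin).trans_le (mul_nonneg hcos.le hp)
    · have hsp : Real.sin θ < p := lt_of_pow_lt_pow_left₀ 2 hp (by nlinarith)
      exact mul_lt_mul'' h hsp ht hsin.le
  · refine iff_of_false (not_lt.2 ?_) h.not_gt
    have hps : p ≤ Real.sin θ := le_of_sq_le_sq (by nlinarith) hsin.le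
    exact mul_le_mul h hps hp (hcos.le.trans h)

theorem sphericalCap_eq (hn : 2 ≤ n) {θ : ℝ} (hθ : θ ∈ Ioo 0 (Real.pi / 2)) :
    sphericalCap n hn θ = {ξ | height (eLast n hn) ξ < Real.cos θ} := by
  ext ξ
  rw [sphericalCap, mem_ofPred_eq, ← height_eLast]
  exact lt_cot_mul_iff_lt_cos hθ (Real.sqrt_nonneg _) (height_eLast_sq_add_normPrime_sq hn ξ)

theorem exists_rayleighQuotient_lt_on_sphericalCap (hn : 2 ≤ n) {θ : ℝ}
    (hθ : θ ∈ Ioo 0 (Real.pi / 2)) :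
    ∃ φ, IsSphericalTestFunction (sphericalCap n hn θ) φ ∧ φ ≠ 0 ∧ rayleighQuotient φ < n - 1 := by
  rw [sphericalCap_eq hn hθ]
  exact exists_rayleighQuotient_lt_on_cap hn _ (cos_pos_of_mem_Ioo_zero_pi_div_two hθ)

theorem capEigenvalue_lt (hn : 2 ≤ n) {θ : ℝ} (hθ : θ ∈ Ioo 0 (Real.pi / 2)) :
    capEigenvalue n hn θ < n - 1 := by
  obtain ⟨φ, hφ, hφ0, hlt⟩ := exists_rayleighQuotient_lt_on_sphericalCap hn hθ
  exact (firstDirichletEigenvalue_le_rayleighQuotient hφ hφ0).trans_lt hlt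

end Cap

section Indicator

theorem tsupport_indicator_subset_of_eq_zero {X M : Type*} [TopologicalSpace X] [Zero M]
    {U K : Set X} {f : X → M} (hK : IsClosed K) (hf0 : ∀ x ∈ U \ K, f x = 0) :
    tsupport (U.indicator f) ⊆ K := by
  refine closure_minimal (fun x hx => ?_) hK
  have ⟨hxU, hfx⟩ := indicator_apply_ne_zero.1 hx
  by_contra hxK
  exact hfx (hf0 x ⟨hxU, hxK⟩)

theorem contDiff_indicator_of_eq_zero {F G : Type*} [NormedAddCommGroup F] [NormedSpace ℝ F]
    [NormedAddCommGroup G] [NormedSpace ℝ G] {U K : Set F} {f : F → G} {k : WithTop ℕ∞}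
    (hU : IsOpen U) (hK : IsClosed K) (hKU : K ⊆ U) (hf : ContDiffOn ℝ k f U)
    (hf0 : ∀ x ∈ U \ K, f x = 0) : ContDiff ℝ k (U.indicator f) := by
  rw [contDiff_iff_contDiffAt]
  intro x
  by_cases hx : x ∈ U
  · exact (hf.contDiffAt (hU.mem_nhds hx)).congr_of_eventuallyEq
      (eqOn_indicator.eventuallyEq_of_mem (hU.mem_nhds hx))
  · refine contDiffAt_const (c := 0) |>.congr_of_eventuallyEq ?_
    filter_upwards [hK.isOpen_compl.mem_nhds fun h => hx (hKU h)] with y hy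
    exact indicator_apply_eq_zero.2 fun hyU => hf0 y ⟨hyU, hy⟩

end Indicator

section Interval

theorem integral_deriv_sq_le_of_neg_mul_deriv_deriv_le {v : ℝ → ℝ} (hv2 : ContDiff ℝ 2 v)
    (hv : HasCompactSupport v) {l : ℝ} (hl : ∀ s, -(v s * deriv (deriv v) s) ≤ l * v s ^ 2) :
    ∫ s, deriv v s ^ 2 ≤ l * ∫ s, v s ^ 2 := by
  have hv' : ContDiff ℝ 1 (deriv v) := hv2.deriv'
  have hparts := integral_mul_deriv_eq_deriv_mul_of_integrable
    (fun s _ => (hv2.differentiable two_ne_zero s).hasDerivAt)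
    (fun s _ => (hv'.differentiable one_ne_zero s).hasDerivAt)
    (integrable_mul_of_hasCompactSupport hv2.continuous hv (hv'.continuous_deriv le_rfl))
    (integrable_mul_of_hasCompactSupport hv'.continuous hv.deriv hv'.continuous)
    (integrable_mul_of_hasCompactSupport hv2.continuous hv hv'.continuous)
  calc ∫ s, deriv v s ^ 2
      = ∫ s, -(v s * deriv (deriv v) s) := by
        rw [integral_neg, hparts, neg_neg]
        simp only [sq]
    _ ≤ ∫ s, l * v s ^ 2 := by
        refine integral_mono (integrable_mul_of_hasCompactSupport hv2.continuous hv
          (hv'.continuous_deriv le_rfl)).neg ?_ hl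
        simp only [sq]
        exact (integrable_mul_of_hasCompactSupport hv2.continuous hv hv2.continuous).const_mul l
    _ = l * ∫ s, v s ^ 2 := integral_const_mul _ _

theorem IsConvexProfile.neg_mul_deriv_deriv_comp_le {d : ℝ} {g : ℝ → ℝ} (hg : IsConvexProfile d g)
    {p : ℝ → ℝ} (hp : ContDiff ℝ 2 p) {l s : ℝ} (hl : 0 ≤ l)
    (hp'' : deriv (deriv p) s = -l * p s) :
    -(g (p s) * deriv (deriv (g ∘ p)) s) ≤ l * g (p s) ^ 2 := by
  have hp' : Differentiable ℝ p := hp.differentiable two_ne_zero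
  have hdp : ContDiff ℝ 1 (deriv p) := hp.deriv'
  have hcomp : deriv (g ∘ p) = fun s => deriv g (p s) * deriv p s :=
    funext fun s => deriv_comp s (hg.smooth.differentiable (by simp) _) (hp' s)
  have hcomp2 : deriv (deriv (g ∘ p)) s =
      deriv (deriv g) (p s) * deriv p s ^ 2 - l * (p s * deriv g (p s)) := by
    rw [hcomp]
    have h := (((hg.contDiff_deriv.differentiable (by simp) _).hasDerivAt.comp s
      (hp' s).hasDerivAt).mul (hdp.differentiable one_ne_zero s).hasDerivAt).deriv
    refine h.trans ?_
    rw [hp'', Function.comp_apply]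
    ring
  have hconvex : 0 ≤ g (p s) * (deriv (deriv g) (p s) * deriv p s ^ 2) :=
    mul_nonneg (hg.nonneg _) (mul_nonneg (hg.convex _) (sq_nonneg _))
  rw [hcomp2]
  linarith [mul_le_mul_of_nonneg_left (hg.mul_mul_deriv_le (p s)) hl]

theorem exists_integral_deriv_sq_le_of_deriv_deriv_eq {a b c l : ℝ} (hl : 0 ≤ l) {p : ℝ → ℝ}
    (hp : ContDiff ℝ ∞ p) (hp'' : ∀ s, deriv (deriv p) s = -l * p s) (hpa : 0 < p a)
    (hpb : 0 < p b) (hc : c ∈ Ioo a b) (hpc : p c ≤ 0) :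
    ∃ v : ℝ → ℝ, ContDiff ℝ ∞ v ∧ HasCompactSupport v ∧ tsupport v ⊆ Ioo a b ∧
      0 < ∫ s, v s ^ 2 ∧ ∫ s, deriv v s ^ 2 ≤ l * ∫ s, v s ^ 2 := by
  obtain ⟨d, hd, hdlt⟩ := exists_between (lt_min hpa hpb)
  have ⟨hda, hdb⟩ := lt_min_iff.1 hdlt
  obtain ⟨g, hg⟩ := exists_isConvexProfile hd
  let K : Set ℝ := Icc a b ∩ {s | p s ≤ d}
  have hK : IsCompact K := isCompact_Icc.inter_right (isClosed_le hp.continuous continuous_const)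
  have hKU : K ⊆ Ioo a b := by
    rintro s ⟨hs, hps : p s ≤ d⟩
    exact ⟨hs.1.lt_of_ne fun h => (h ▸ hda).not_ge hps, hs.2.lt_of_ne fun h => (h ▸ hdb).not_ge hps⟩
  have hgp0 : ∀ s ∈ Ioo a b \ K, (g ∘ p) s = 0 := fun s ⟨hs, hsK⟩ =>
    hg.eq_zero _ (not_le.1 fun h => hsK ⟨Ioo_subset_Icc_self hs, h⟩).le
  obtain ⟨v, hv_def⟩ : ∃ v, v = (Ioo a b).indicator (g ∘ p) := ⟨_, rfl⟩
  have hv : ContDiff ℝ ∞ v := hv_def ▸ contDiff_indicator_of_eq_zero isOpen_Ioo hK.isClosed hKU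
    (hg.smooth.comp hp).contDiffOn hgp0
  have hvK : tsupport v ⊆ K := hv_def ▸ tsupport_indicator_subset_of_eq_zero hK.isClosed hgp0
  have hvc : HasCompactSupport v := hK.of_isClosed_subset (isClosed_tsupport v) hvK
  refine ⟨v, hv, hvc, hvK.trans hKU, ?pos, ?le⟩
  case pos =>
    have hvcpos : v c ≠ 0 := by
      rw [hv_def, indicator_of_mem hc]
      exact (hg.pos _ (hpc.trans_lt hd)).ne'
    simp only [sq]
    exact (hv.continuous.mul hv.continuous).integral_pos_of_hasCompactSupport_nonneg_nonzero
      hvc.mul_right (fun _ => mul_self_nonneg _) (mul_self_ne_zero.2 hvcpos)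
  case le =>
    refine integral_deriv_sq_le_of_neg_mul_deriv_deriv_le (contDiff_infty.1 hv 2) hvc fun s => ?_
    by_cases hs : s ∈ Ioo a b
    · have hloc : v =ᶠ[nhds s] g ∘ p :=
        hv_def ▸ eqOn_indicator.eventuallyEq_of_mem (isOpen_Ioo.mem_nhds hs)
      rw [hloc.deriv.deriv_eq, hloc.eq_of_nhds]
      exact hg.neg_mul_deriv_deriv_comp_le (contDiff_infty.1 hp 2) hl (hp'' s)
    · rw [hv_def, indicator_of_notMem hs]
      simp

theorem exists_frequency {L κ : ℝ} (hL : 0 < L) (hκ : (Real.pi / L) ^ 2 < κ) :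
    ∃ ν, Real.pi / 2 < ν * (L / 2) ∧ ν * (L / 2) < Real.pi ∧ ν ^ 2 < κ := by
  have hπ := Real.pi_pos
  have hlt : Real.pi / L < min √κ (2 * (Real.pi / L)) := by
    refine lt_min ((Real.lt_sqrt (by positivity)).2 hκ) ?_
    linarith [div_pos hπ hL]
  obtain ⟨ν, hν, hν'⟩ := exists_between hlt
  have hν0 : 0 < ν := (div_pos hπ hL).trans hν
  have hupper := hν'.trans_le (min_le_right _ _)
  rw [div_lt_iff₀ hL] at hν
  rw [← mul_div_assoc, lt_div_iff₀ hL] at hupper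
  exact ⟨ν, by linarith, by linarith,
    (Real.lt_sqrt hν0.le).1 (hν'.trans_le (min_le_left _ _))⟩

theorem deriv_deriv_neg_cos (ν m s : ℝ) :
    deriv (deriv fun s => -Real.cos (ν * (s - m))) s = -ν ^ 2 * -Real.cos (ν * (s - m)) := by
  have hlin (s : ℝ) : HasDerivAt (fun s => ν * (s - m)) ν s := by
    simpa using ((hasDerivAt_id s).sub_const m).const_mul ν
  have h1 : deriv (fun s => -Real.cos (ν * (s - m))) = fun s => Real.sin (ν * (s - m)) * ν := by
    ext s
    simpa using (hlin s).cos.neg.deriv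
  rw [h1, ((hlin s).sin.mul_const ν).deriv]
  ring

theorem exists_integral_deriv_sq_lt {a b κ : ℝ} (hab : a < b)
    (hκ : (Real.pi / (b - a)) ^ 2 < κ) :
    ∃ v : ℝ → ℝ, ContDiff ℝ ∞ v ∧ HasCompactSupport v ∧ tsupport v ⊆ Ioo a b ∧
      0 < ∫ s, v s ^ 2 ∧ ∫ s, deriv v s ^ 2 < κ * ∫ s, v s ^ 2 := by
  obtain ⟨ν, hν, hνπ, hνκ⟩ := exists_frequency (sub_pos.2 hab) hκ
  let p : ℝ → ℝ := fun s => -Real.cos (ν * (s - (a + b) / 2))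
  have hend : 0 < -Real.cos (ν * ((b - a) / 2)) :=
    neg_pos.2 (Real.cos_neg_of_pi_div_two_lt_of_lt hν (by linarith [Real.pi_pos]))
  have hpa : p a = -Real.cos (ν * ((b - a) / 2)) := by
    rw [← Real.cos_neg (ν * ((b - a) / 2))]
    simp only [p]
    ring_nf
  have hpb : p b = -Real.cos (ν * ((b - a) / 2)) := by
    simp only [p]
    ring_nf
  have hpmid : p ((a + b) / 2) ≤ 0 := by simp [p]
  obtain ⟨v, hv, hvc, hvab, hvpos, hle⟩ := exists_integral_deriv_sq_le_of_deriv_deriv_eq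
    (sq_nonneg ν) (show ContDiff ℝ ∞ p by fun_prop) (deriv_deriv_neg_cos ν _) (hpa ▸ hend)
    (hpb ▸ hend) ⟨left_lt_add_div_two.2 hab, add_div_two_lt_right.2 hab⟩ hpmid
  exact ⟨v, hv, hvc, hvab, hvpos, hle.trans_lt (mul_lt_mul_of_pos_right hνκ hvpos)⟩

theorem exp_neg_half_mul_sq_mul_exp (c s : ℝ) :
    Real.exp (-(c / 2) * s) ^ 2 * Real.exp (c * s) = 1 := by
  rw [← Real.exp_nat_mul, ← Real.exp_add, Real.exp_eq_one_iff]
  push_cast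
  ring

theorem integral_mul_exp_sq_mul_exp (v : ℝ → ℝ) (c : ℝ) :
    ∫ s, (v s * Real.exp (-(c / 2) * s)) ^ 2 * Real.exp (c * s) = ∫ s, v s ^ 2 := by
  simp only [mul_pow, mul_assoc, exp_neg_half_mul_sq_mul_exp, mul_one]

theorem integral_deriv_mul_exp_sq_mul_exp {v : ℝ → ℝ} (hv1 : ContDiff ℝ 1 v)
    (hv : HasCompactSupport v) (c : ℝ) :
    ∫ s, deriv (fun s => v s * Real.exp (-(c / 2) * s)) s ^ 2 * Real.exp (c * s) =
      (∫ s, deriv v s ^ 2) + (c / 2) ^ 2 * ∫ s, v s ^ 2 := by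
  have hv' : Continuous (deriv v) := hv1.continuous_deriv le_rfl
  have hpointwise (s : ℝ) :
      deriv (fun s => v s * Real.exp (-(c / 2) * s)) s ^ 2 * Real.exp (c * s) =
        deriv v s * deriv v s + (c / 2) ^ 2 * (v s * v s) -
          c / 2 * deriv (fun s => v s * v s) s := by
    have hd := (hv1.differentiable one_ne_zero s).hasDerivAt
    have hexp : HasDerivAt (fun s => Real.exp (-(c / 2) * s))
        (Real.exp (-(c / 2) * s) * (-(c / 2))) s := by
      simpa using ((hasDerivAt_id s).const_mul (-(c / 2))).exp
    rw [(hd.fun_mul hexp).deriv, (hd.fun_mul hd).deriv]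
    linear_combination (deriv v s - c / 2 * v s) ^ 2 * exp_neg_half_mul_sq_mul_exp c s
  have hzero : ∫ s, deriv (fun s => v s * v s) s = 0 := by
    simpa using integral_fderiv_apply_eq_zero (μ := volume) (hv1.mul hv1) hv.mul_right 1
  have hvv : ContDiff ℝ 1 fun s => v s * v s := hv1.mul hv1
  have hint_v' := integrable_mul_of_hasCompactSupport (μ := volume) hv' hv.deriv hv'
  have hint_v := (integrable_mul_of_hasCompactSupport (μ := volume) hv1.continuous hv
    hv1.continuous).const_mul ((c / 2) ^ 2)
  have hint_vv : Integrable fun s => c / 2 * deriv (fun s => v s * v s) s :=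
    ((hvv.continuous_deriv le_rfl).integrable_of_hasCompactSupport hv.mul_right.deriv).const_mul _
  simp only [hpointwise, sq (v _), sq (deriv v _)]
  rw [integral_sub (by exact hint_v'.add hint_v) hint_vv, integral_add hint_v' hint_v,
    integral_const_mul, integral_const_mul, hzero, mul_zero, sub_zero]

end Interval

section HardyQuotient

variable {n : ℕ} {U V : Set (E n)} {u : E n → ℝ}

theorem IsTestFunction.mono (hUV : U ⊆ V) (hu : IsTestFunction U u) : IsTestFunction V u :=
  ⟨hu.smooth, hu.compact, hu.support_subset.trans hUV⟩

theorem IsTestFunction.energy_eq (hu : IsTestFunction U u) :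
    energy U u = ∫ x, ‖gradient u x‖ ^ 2 := by
  refine setIntegral_eq_integral_of_forall_compl_eq_zero fun x hx => ?_
  have hux : u =ᶠ[nhds x] fun _ => 0 :=
    notMem_tsupport_iff_eventuallyEq.1 fun h => hx (hu.support_subset h)
  rw [hux.gradient_eq, gradient_fun_const, norm_zero, zero_pow two_ne_zero]

theorem IsTestFunction.hardyTerm_eq (hu : IsTestFunction U u) :
    hardyTerm U u = ∫ x, u x ^ 2 / ‖x‖ ^ 2 := by
  refine setIntegral_eq_integral_of_forall_compl_eq_zero fun x hx => ?_
  rw [image_eq_zero_of_notMem_tsupport fun h => hx (hu.support_subset h), zero_pow two_ne_zero,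
    zero_div]

theorem bddBelow_hardyQuotients (U : Set (E n)) :
    BddBelow {q : ℝ | ∃ u, IsTestFunction U u ∧ u ≠ 0 ∧ q = energy U u / hardyTerm U u} := by
  refine ⟨0, ?_⟩
  rintro q ⟨u, -, -, rfl⟩
  exact div_nonneg (integral_nonneg fun _ => sq_nonneg _) (integral_nonneg fun _ => by positivity)

theorem hardyConstant_le_div (hu : IsTestFunction U u) (hu0 : u ≠ 0) :
    hardyConstant U ≤ energy U u / hardyTerm U u :=
  csInf_le (bddBelow_hardyQuotients U) ⟨u, hu, hu0, rfl⟩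

theorem hardyConstant_anti (hUV : U ⊆ V) (hU : ∃ u, IsTestFunction U u ∧ u ≠ 0) :
    hardyConstant V ≤ hardyConstant U := by
  obtain ⟨u₀, hu₀, hu₀0⟩ := hU
  refine le_csInf ⟨_, u₀, hu₀, hu₀0, rfl⟩ ?_
  rintro q ⟨u, hu, hu0, rfl⟩
  have huV := hu.mono hUV
  rw [hu.energy_eq, hu.hardyTerm_eq, ← huV.energy_eq, ← huV.hardyTerm_eq]
  exact hardyConstant_le_div huV hu0

theorem ne_zero_of_hardyTerm_pos (hu : 0 < hardyTerm U u) : u ≠ 0 := by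
  rintro rfl
  simp [hardyTerm] at hu

end HardyQuotient

section TruncatedCone

variable {n : ℕ}

theorem exists_isTestFunction_energy_lt_of_exp_smul_mem [Nontrivial (E n)] {Ω : Set (E n)}
    {U : Set (S n)} {a b κ : ℝ} (hab : a < b)
    (hΩ : ∀ s ∈ Ioo a b, ∀ ξ ∈ U, Real.exp s • (ξ : E n) ∈ Ω) {φ : S n → ℝ}
    (hφ : IsSphericalTestFunction U φ) (hφ0 : φ ≠ 0)
    (hκ : (((n : ℝ) - 2) / 2) ^ 2 + rayleighQuotient φ + (Real.pi / (b - a)) ^ 2 < κ) :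
    ∃ u, IsTestFunction Ω u ∧ 0 < hardyTerm Ω u ∧ energy Ω u < κ * hardyTerm Ω u := by
  obtain ⟨v, hv, hvc, hvab, hvpos, hvlt⟩ := exists_integral_deriv_sq_lt hab
    (lt_sub_iff_add_lt'.2 hκ)
  have hv1 : ContDiff ℝ 1 v := contDiff_infty.1 hv 1
  let w : ℝ → ℝ := fun s => v s * Real.exp (-(((n : ℝ) - 2) / 2) * s)
  have hw : ContDiff ℝ ∞ w := hv.mul (by fun_prop)
  have hwc : HasCompactSupport w := hvc.mul_right
  have hu : IsTestFunction Ω (logProduct w φ) := by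
    refine ⟨contDiff_logProduct hwc hw hφ.smooth, hasCompactSupport_logProduct hwc φ, ?_⟩
    refine (tsupport_logProduct_subset hwc φ).trans (image_subset_iff.2 ?_)
    exact fun p hp => hΩ p.1 (hvab (tsupport_mul_subset_left hp.1)) p.2 (hφ.support_subset hp.2)
  have hφpos := hφ.integral_sq_pos hφ0
  have hRayleigh : ∫ ξ, ‖sphericalGradient φ ξ‖ ^ 2 ∂.toSphere volume =
      rayleighQuotient φ * ∫ ξ, φ ξ ^ 2 ∂.toSphere volume :=
    (div_mul_cancel₀ _ hφpos.ne').symm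
  have hhardy : hardyTerm Ω (logProduct w φ) =
      (∫ ξ, φ ξ ^ 2 ∂.toSphere volume) * ∫ s, v s ^ 2 := by
    rw [hu.hardyTerm_eq, integral_logProduct_sq_div_norm_sq, integral_mul_exp_sq_mul_exp]
  have henergy : energy Ω (logProduct w φ) = (∫ ξ, φ ξ ^ 2 ∂.toSphere volume) *
      ((∫ s, deriv v s ^ 2) +
        ((((n : ℝ) - 2) / 2) ^ 2 + rayleighQuotient φ) * ∫ s, v s ^ 2) := by
    rw [hu.energy_eq, integral_norm_gradient_logProduct_sq hwc (contDiff_infty.1 hw 1)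
      (hφ.smooth.of_le (mod_cast le_top)), integral_deriv_mul_exp_sq_mul_exp hv1 hvc,
      integral_mul_exp_sq_mul_exp, hRayleigh]
    ring
  refine ⟨logProduct w φ, hu, hhardy ▸ mul_pos hφpos hvpos, ?_⟩
  rw [henergy, hhardy, mul_left_comm]
  exact mul_lt_mul_of_pos_left (by linarith) hφpos

theorem log_neg_and_pi_div_log_sq_lt {x l : ℝ} (hx : 0 < x) (hl : 0 < l)
    (h : x < Real.exp (-(Real.pi / √l))) :
    Real.log x < 0 ∧ (Real.pi / Real.log x) ^ 2 < l := by
  have hsqrt : 0 < √l := Real.sqrt_pos.2 hl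
  have hlt : Real.pi / √l < -Real.log x := lt_neg.1 ((Real.log_lt_iff_lt_exp hx).2 h)
  have hlog : 0 < -Real.log x := (div_pos Real.pi_pos hsqrt).trans hlt
  refine ⟨neg_pos.1 hlog, ?_⟩
  rw [← neg_sq, ← div_neg, ← Real.lt_sqrt (div_pos Real.pi_pos hlog).le]
  exact (div_lt_comm₀ hsqrt hlog).1 hlt

theorem normPrime_smul (hn : 2 ≤ n) {r : ℝ} (hr : 0 ≤ r) (x : E n) :
    normPrime hn (r • x) = r * normPrime hn x := by
  simp only [normPrime, PiLp.smul_apply, smul_eq_mul, mul_pow, ← Finset.mul_sum]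
  rw [Real.sqrt_mul (sq_nonneg r), Real.sqrt_sq hr]

theorem lt_norm_smul_sub_smul_iff {F : Type*} [NormedAddCommGroup F] [InnerProductSpace ℝ F]
    {x e : F} (hx : ‖x‖ = 1) (he : ‖e‖ = 1) {r ρ : ℝ} (hr : 0 < r) (hρ : 0 ≤ ρ) :
    ρ < ‖r • x - ρ • e‖ ↔ 2 * ρ * inner ℝ e x < r := by
  rw [← pow_lt_pow_iff_left₀ hρ (norm_nonneg _) two_ne_zero, norm_sub_sq_real, norm_smul,
    norm_smul, hx, he, real_inner_smul_left, real_inner_smul_right, Real.norm_of_nonneg hr.le,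
    Real.norm_of_nonneg hρ, real_inner_comm,
    ← mul_lt_mul_iff_right₀ (b := 2 * ρ * inner ℝ e x) hr]
  constructor <;> intro h <;> linarith

theorem exp_smul_mem_modelDomain (hn : 2 ≤ n) {ρ θ : ℝ} (hρ : 0 < ρ)
    (hθ : θ ∈ Ioo 0 (Real.pi / 2)) {s : ℝ} (hs : s ∈ Ioo (Real.log (2 * ρ * Real.cos θ)) 0)
    {ξ : S n} (hξ : ξ ∈ sphericalCap n hn θ) :
    Real.exp s • (ξ : E n) ∈ modelDomain n hn ρ θ := by
  have hcos := cos_pos_of_mem_Ioo_zero_pi_div_two hθ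
  have hr := Real.exp_pos s
  refine ⟨?ball, ?cone, ?exterior⟩
  case ball =>
    rw [mem_ball_zero_iff, norm_exp_smul_sphere]
    exact Real.exp_lt_one_iff.2 hs.2
  case cone =>
    rw [normPrime_smul hn hr.le, PiLp.smul_apply, smul_eq_mul, mul_left_comm]
    exact mul_lt_mul_of_pos_left hξ hr
  case exterior =>
    have hheight : height (eLast n hn) ξ < Real.cos θ := (sphericalCap_eq hn hθ).subset hξ
    rw [lt_norm_smul_sub_smul_iff (norm_eq_of_mem_sphere ξ) (norm_eLast hn) hr hρ.le]
    exact (mul_lt_mul_of_pos_left hheight (by positivity)).trans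
      ((Real.log_lt_iff_lt_exp (by positivity)).1 hs.1)

theorem exists_isTestFunction_modelDomain (hn : 2 ≤ n) {ρ θ : ℝ} (hρ : 0 < ρ)
    (hθ : θ ∈ Ioo 0 (Real.pi / 2))
    (h : ρ < 1 / (2 * Real.cos θ) *
      Real.exp (-(Real.pi / √((n : ℝ) - 1 - capEigenvalue n hn θ)))) :
    ∃ u, IsTestFunction (modelDomain n hn ρ θ) u ∧ 0 < hardyTerm (modelDomain n hn ρ θ) u ∧
      energy (modelDomain n hn ρ θ) u < (n : ℝ) ^ 2 / 4 * hardyTerm (modelDomain n hn ρ θ) u := by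
  have := nontrivial_of_two_le hn
  have hcos := cos_pos_of_mem_Ioo_zero_pi_div_two hθ
  have hradius : 2 * ρ * Real.cos θ <
      Real.exp (-(Real.pi / √((n : ℝ) - 1 - capEigenvalue n hn θ))) := by
    rw [one_div_mul_eq_div, lt_div_iff₀ (by positivity)] at h
    linarith
  obtain ⟨hlog, hgap⟩ := log_neg_and_pi_div_log_sq_lt (by positivity)
    (sub_pos.2 (capEigenvalue_lt hn hθ)) hradius
  obtain ⟨φ₀, hφ₀, hφ₀0, -⟩ := exists_rayleighQuotient_lt_on_sphericalCap hn hθ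
  obtain ⟨φ, hφ, hφ0, hRayleigh⟩ := exists_rayleighQuotient_lt ⟨φ₀, hφ₀, hφ₀0⟩ (lt_sub_comm.1 hgap)
  refine exists_isTestFunction_energy_lt_of_exp_smul_mem hlog
    (fun s hs ξ hξ => exp_smul_mem_modelDomain hn hρ hθ hs hξ) hφ hφ0 ?_
  rw [zero_sub, div_neg, neg_sq]
  linarith [show (((n : ℝ) - 2) / 2) ^ 2 + (n - 1) = n ^ 2 / 4 by ring]

end TruncatedCone

end HardyBoundary

theorem mainTheorem12_general (n : ℕ) (hn : 2 ≤ n) (ρ θ : ℝ)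
    (hρ : 0 < ρ) (hθ : θ ∈ Set.Ioo (0 : ℝ) (Real.pi / 2))
    (Ω : Set (HardyBoundary.E n)) (hsub : HardyBoundary.modelDomain n hn ρ θ ⊆ Ω) :
    HardyBoundary.capEigenvalue n hn θ < (n : ℝ) - 1 ∧
    (ρ < 1 / (2 * Real.cos θ) *
          Real.exp (-(Real.pi / √((n : ℝ) - 1 - HardyBoundary.capEigenvalue n hn θ))) →
      HardyBoundary.hardyConstant Ω ≤
          HardyBoundary.hardyConstant (HardyBoundary.modelDomain n hn ρ θ) ∧
      HardyBoundary.hardyConstant (HardyBoundary.modelDomain n hn ρ θ) < (n : ℝ) ^ 2 / 4 ∧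
      ∃ u : HardyBoundary.E n → ℝ, HardyBoundary.IsTestFunction Ω u ∧
        HardyBoundary.energy Ω u < (n : ℝ) ^ 2 / 4 * HardyBoundary.hardyTerm Ω u) := by
  refine ⟨HardyBoundary.capEigenvalue_lt hn hθ, fun h => ?_⟩
  obtain ⟨u, hu, hpos, hlt⟩ := HardyBoundary.exists_isTestFunction_modelDomain hn hρ hθ h
  have hu0 : u ≠ 0 := HardyBoundary.ne_zero_of_hardyTerm_pos hpos
  have huΩ := hu.mono hsub
  refine ⟨HardyBoundary.hardyConstant_anti hsub ⟨u, hu, hu0⟩, ?_, u, huΩ, ?_⟩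
  · exact (HardyBoundary.hardyConstant_le_div hu hu0).trans_lt ((div_lt_iff₀ hpos).2 hlt)
  · rwa [huΩ.energy_eq, huΩ.hardyTerm_eq, ← hu.energy_eq, ← hu.hardyTerm_eq]

theorem mainTheorem12 (n : ℕ) (hn : 2 ≤ n) (ρ θ : ℝ)
    (hρ : ρ ∈ Set.Ioo (0 : ℝ) (1 / 2)) (hθ : θ ∈ Set.Ioo (0 : ℝ) (Real.pi / 2))
    (Ω : Set (HardyBoundary.E n)) (hΩo : IsOpen Ω) (hΩc : IsConnected Ω)
    (hsub : HardyBoundary.modelDomain n hn ρ θ ⊆ Ω)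
    (hball : HardyBoundary.IsLargestExteriorBallAtZero Ω (ρ • HardyBoundary.eLast n hn) ρ) :
    HardyBoundary.capEigenvalue n hn θ < (n : ℝ) - 1 ∧
    (ρ < 1 / (2 * Real.cos θ) *
          Real.exp (-(Real.pi / √((n : ℝ) - 1 - HardyBoundary.capEigenvalue n hn θ))) →
      HardyBoundary.hardyConstant Ω ≤
          HardyBoundary.hardyConstant (HardyBoundary.modelDomain n hn ρ θ) ∧
      HardyBoundary.hardyConstant (HardyBoundary.modelDomain n hn ρ θ) < (n : ℝ) ^ 2 / 4 ∧
      ∃ u : HardyBoundary.E n → ℝ, HardyBoundary.IsTestFunction Ω u ∧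
        HardyBoundary.energy Ω u < (n : ℝ) ^ 2 / 4 * HardyBoundary.hardyTerm Ω u) :=
  mainTheorem12_general n hn ρ θ hρ.1 hθ Ω hsub
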